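/- Let $n\ge 1$ be an integer. For $\alpha>0$ let $$\Phi_\alpha(x,t)=\frac{t^{\alpha-1}}{\Gamma(\alpha)}\,\frac{1}{(4\pi t)^{n/2}}\,e^{-|x|^2/(4t)}\ \text{ for } x\in\mathbb{R}^n,\ t>0,\qquad \Phi_\alpha(x,t)=0\ \text{ for } x\in\mathbb{R}^n,\ t\le 0.$$ Let $X^1$ be the set of measurable $f:\mathbb{R}^n\times\mathbb{R}\to\mathbb{R}$ with $\|f\|_{L^1(\mathbb{R}^n\times(-\infty,T))}<\infty$ for all $T\in\mathbb{R}$. For $f\in X^1$ and $0<\alpha\le (n+2)/2$ let $$J_\alpha f(x,t)=\iint_{\mathbb{R}^n\times(-\infty,t)}\Phi_\alpha(x-\xi,t-\tau)f(\xi,\tau)\,d\xi\,d\tau,$$ and let $Y^1_\alpha=J_\alpha(X^1)$. Functions are identified when they agree almost everywhere, and equalities and inequalities between them are understood almost everywhere. The fractional heat operator $(\partial_t-\Delta)^\alpha:Y^1_\alpha\to X^1$ is the inverse of $J_\alpha:X^1\to Y^1_\alpha$; that is, $(\partial_t-\Delta)^\alpha u=f$ means $f\in X^1$ and $u=J_\alpha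 f$. Corollary 1.2. Suppose $0<\alpha\le (n+2)/2$ and $\lambda>1$. Then the problem $$(\partial_t-\Delta)^\alpha u\ge u^\lambda\ \text{ in } \mathbb{R}^n\times\mathbb{R},\qquad u=0\ \text{ in } \mathbb{R}^n\times(-\infty,0)$$ has a nontrivial (that is, not almost everywhere zero) nonnegative solution $u\in Y^1_\alpha$ if and only if $$\alpha\neq\frac{n+2}{2}\quad\text{and}\quad \lambda>\lambda_0(n,\alpha):=1+\frac{2\alpha}{n+2-2\alpha}.$$ Moreover $\lambda_0(n,1)=1+2/n$. -/

import Mathlib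

open MeasureTheory Set

noncomputable section

namespace FracHeat

/-- Space-time `ℝⁿ × ℝ`, with the Euclidean norm on `ℝⁿ` and Lebesgue measure. Functions on it are
considered up to equality almost everywhere, and (in)equalities between them hold almost
everywhere. -/
abbrev SpaceTime (n : ℕ) : Type := EuclideanSpace ℝ (Fin n) × ℝ

/-- The fractional heat kernel
`Φ_α(x,t) = t^(α-1)/Γ(α) · (4πt)^(-n/2) · exp(-|x|²/(4t))` for `t > 0`, and `0` for `t ≤ 0`. -/
def kernel (n : ℕ) (α : ℝ) (x : EuclideanSpace ℝ (Fin n)) (t : ℝ) : ℝ :=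
  if 0 < t then
    t ^ (α - 1) / Real.Gamma α * (1 / (4 * Real.pi * t) ^ ((n : ℝ) / 2)) *
      Real.exp (-‖x‖ ^ 2 / (4 * t))
  else 0

/-- `ℝⁿ × (-∞, T)`. -/
def past (n : ℕ) (T : ℝ) : Set (SpaceTime n) := univ ×ˢ Iio T

/-- `X^p = ⋂_T L^p(ℝⁿ × (-∞, T))`. -/
def X (n : ℕ) (p : ENNReal) : Set (SpaceTime n → ℝ) :=
  {f | ∀ T : ℝ, MemLp f p (volume.restrict (past n T))}

/-- `J_α f(x,t) = ∬_{ℝⁿ × (-∞,t)} Φ_α(x-ξ, t-τ) f(ξ,τ) dξ dτ`. For `f ∈ X^1` and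
`0 < α ≤ (n+2)/2` the integral converges absolutely for almost every `(x,t)`. -/
def J (n : ℕ) (α : ℝ) (f : SpaceTime n → ℝ) (z : SpaceTime n) : ℝ :=
  ∫ w in past n z.2, kernel n α (z.1 - w.1) (z.2 - w.2) * f w

/-- `Y^p_α = J_α(X^p)`, the image of `X^p` under `J_α`. -/
def Y (n : ℕ) (p : ENNReal) (α : ℝ) : Set (SpaceTime n → ℝ) :=
  {u | ∃ f ∈ X n p, u =ᵐ[volume] J n α f}

/-- The fractional heat operator `(∂_t - Δ)^α : Y^p_α → X^p` is the inverse of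
`J_α : X^p → Y^p_α`. This is its graph: `(∂_t - Δ)^α u = f` means `f ∈ X^p` and `u = J_α f`. -/
def FracHeatEq (n : ℕ) (p : ENNReal) (α : ℝ) (u f : SpaceTime n → ℝ) : Prop :=
  f ∈ X n p ∧ u =ᵐ[volume] J n α f

/-- `u` is a nonnegative solution in `Y^p_α` of
`(∂_t - Δ)^α u ≥ u^λ` in `ℝⁿ × ℝ`, `u = 0` in `ℝⁿ × (-∞, 0)`. -/
structure IsNonnegSuperSolution (n : ℕ) (p : ENNReal) (α lam : ℝ) (u : SpaceTime n → ℝ) :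
    Prop where
  mem : u ∈ Y n p α
  nonneg : ∀ᵐ z, 0 ≤ u z
  super : ∃ f : SpaceTime n → ℝ, FracHeatEq n p α u f ∧ ∀ᵐ z, u z ^ lam ≤ f z
  initial : ∀ᵐ z, z ∈ past n 0 → u z = 0

/-- The critical exponent `λ₀(n, α) = 1 + 2α/(n + 2 - 2α)`. -/
def criticalExponent (n : ℕ) (α : ℝ) : ℝ := 1 + 2 * α / ((n : ℝ) + 2 - 2 * α)

end FracHeat

end

/-! Both conditions on `α` and `lam` amount to `(n+2)/2 < lam * ((n+2)/2 - α)`, which fails by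
itself at `α = (n+2)/2`.

Nonexistence: a solution gives `g ≥ 0` with `(J_α g)^λ ≤ g`. Test this with `(T-t)^β` times the
backward heat kernel `heat n x (2T-t)`. By the semigroup law the adjoint of `J_α` raises the order
`β` to `α + β`, up to a constant. With `β = α/(λ-1)`, a Young-type inequality absorbs the nonlinear
term, and `∫ testFun (α+β) * g ≤ C T` for all `T ≥ 1` (`exists_lintegral_testFun_le`). If `g` is
nontrivial, then `J_α g ≥ c t^(α-(n+2)/2)` on `|x|² ≤ t` for large `t` (`exists_le_pot`). In the
critical and subcritical range this gives `g ≥ c^λ t^(-(n+2)/2)` there, whose integral diverges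
logarithmically, while the test function is at least a multiple of `T`. So the left side outgrows `C
T` (`ae_eq_zero_of_pot_rpow_le`).

Existence: the source `ε (1+t)^(-q) heat n x (1+t)`, `t > 0`, has its potential computed by the
semigroup law. It is at most `ε C (1+t)^(α-1) heat n x (1+t)` when `q > 1`, and supercriticality is
what allows `q > 1` (`exists_source_superSolution`). -/

namespace FracHeat

/-! ### The heat kernel and its semigroup law -/

/-- The Gauss–Weierstrass heat kernel on `ℝⁿ`. -/
noncomputable def heat (n : ℕ) (x : EuclideanSpace ℝ (Fin n)) (t : ℝ) : ℝ :=
  1 / (4 * Real.pi * t) ^ ((n : ℝ) / 2) * Real.exp (-‖x‖ ^ 2 / (4 * t))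

lemma heat_pos {n : ℕ} (x : EuclideanSpace ℝ (Fin n)) {t : ℝ} (ht : 0 < t) : 0 < heat n x t := by
  unfold heat
  positivity

lemma heat_neg {n : ℕ} (x : EuclideanSpace ℝ (Fin n)) (t : ℝ) : heat n (-x) t = heat n x t := by
  simp [heat]

lemma heat_le {n : ℕ} (x : EuclideanSpace ℝ (Fin n)) {t : ℝ} (ht : 0 < t) :
    heat n x t ≤ t ^ (-((n : ℝ) / 2)) := by
  unfold heat
  have h1 : Real.exp (-‖x‖ ^ 2 / (4 * t)) ≤ 1 := by
    rw [Real.exp_le_one_iff]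
    exact div_nonpos_of_nonpos_of_nonneg (by simp) (by positivity)
  have h2 : t ^ ((n : ℝ) / 2) ≤ (4 * Real.pi * t) ^ ((n : ℝ) / 2) := by
    apply Real.rpow_le_rpow ht.le _ (by positivity)
    nlinarith [Real.pi_gt_three]
  rw [Real.rpow_neg ht.le, ← one_div]
  calc _ ≤ 1 / (4 * Real.pi * t) ^ ((n : ℝ) / 2) * 1 := by gcongr
    _ ≤ _ := by
      rw [mul_one]
      gcongr

lemma le_heat {n : ℕ} (x : EuclideanSpace ℝ (Fin n)) {t T : ℝ} (ht : 0 < t) (hT : t ≤ T)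
    (hx : ‖x‖ ^ 2 ≤ 8 * t) :
    (4 * Real.pi) ^ (-((n : ℝ) / 2)) * Real.exp (-2) * T ^ (-((n : ℝ) / 2)) ≤ heat n x t := by
  unfold heat
  have hT0 : 0 < T := ht.trans_le hT
  have h1 : Real.exp (-2) ≤ Real.exp (-‖x‖ ^ 2 / (4 * t)) := by
    apply Real.exp_le_exp.2
    rw [le_div_iff₀ (by positivity)]
    linarith
  rw [mul_right_comm, ← Real.mul_rpow (by positivity) hT0.le, Real.rpow_neg (by positivity),
    ← one_div]
  gcongr

lemma measurable_heat (n : ℕ) : Measurable (fun p : SpaceTime n => heat n p.1 p.2) := by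
  unfold heat
  fun_prop

lemma integral_heat {n : ℕ} {t : ℝ} (ht : 0 < t) :
    ∫ x, heat n x t = 1 := by
  have h := GaussianFourier.integral_rexp_neg_mul_sq_norm (V := EuclideanSpace ℝ (Fin n))
    (b := 1 / (4 * t)) (by positivity)
  have e : ∀ x : EuclideanSpace ℝ (Fin n), heat n x t =
      1 / (4 * Real.pi * t) ^ ((n : ℝ) / 2) * Real.exp (-(1 / (4 * t)) * ‖x‖ ^ 2) := by
    intro x
    unfold heat
    congr 2
    ring
  simp_rw [e]
  rw [integral_const_mul, h]
  have : Real.pi / (1 / (4 * t)) = 4 * Real.pi * t := by field_simp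
  rw [this, finrank_euclideanSpace_fin]
  field_simp

lemma lintegral_heat {n : ℕ} {t : ℝ} (ht : 0 < t) :
    ∫⁻ x, ENNReal.ofReal (heat n x t) = 1 := by
  have hi : Integrable (fun x => heat n x t) :=
    Integrable.of_integral_ne_zero (by rw [integral_heat ht]; norm_num)
  rw [← ofReal_integral_eq_lintegral_ofReal hi (.of_forall fun x => (heat_pos x ht).le),
    integral_heat ht, ENNReal.ofReal_one]

/-- Completing the square in `y`. The second factor on the right is a Gaussian of mass one in `y`,
so integration yields the semigroup law. -/
lemma heat_mul_heat {n : ℕ} (x y : EuclideanSpace ℝ (Fin n)) {s r : ℝ} (hs : 0 < s) (hr : 0 < r) :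
    heat n (x - y) s * heat n y r =
      heat n x (s + r) * heat n (y - (r / (s + r)) • x) (s * r / (s + r)) := by
  have hsr : 0 < s + r := add_pos hs hr
  unfold heat
  have h1 : (4 * Real.pi * s) ^ ((n : ℝ) / 2) * (4 * Real.pi * r) ^ ((n : ℝ) / 2) =
      (4 * Real.pi * (s + r)) ^ ((n : ℝ) / 2) *
        (4 * Real.pi * (s * r / (s + r))) ^ ((n : ℝ) / 2) := by
    rw [← Real.mul_rpow (by positivity) (by positivity),
      ← Real.mul_rpow (by positivity) (by positivity)]
    congr 1
    field_simp
  have h2 : -‖x - y‖ ^ 2 / (4 * s) + -‖y‖ ^ 2 / (4 * r) =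
      -‖x‖ ^ 2 / (4 * (s + r)) +
        -‖y - (r / (s + r)) • x‖ ^ 2 / (4 * (s * r / (s + r))) := by
    rw [norm_sub_sq_real, norm_sub_sq_real, inner_smul_right, norm_smul, real_inner_comm,
      Real.norm_of_nonneg (by positivity)]
    field_simp
    ring
  rw [mul_mul_mul_comm, mul_mul_mul_comm (1 / _) _ (1 / _), ← Real.exp_add, ← Real.exp_add, h2,
    div_mul_div_comm, div_mul_div_comm, h1]

lemma lintegral_heat_mul_heat {n : ℕ} (x : EuclideanSpace ℝ (Fin n)) {s r : ℝ} (hs : 0 < s)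
    (hr : 0 < r) :
    ∫⁻ y, ENNReal.ofReal (heat n (x - y) s * heat n y r) = ENNReal.ofReal (heat n x (s + r)) := by
  have hsr : 0 < s + r := add_pos hs hr
  simp_rw [heat_mul_heat _ _ hs hr, ENNReal.ofReal_mul (heat_pos x hsr).le]
  rw [lintegral_const_mul' _ _ ENNReal.ofReal_ne_top,
    lintegral_sub_right_eq_self (fun y => ENNReal.ofReal (heat n y (s * r / (s + r)))),
    lintegral_heat (by positivity), mul_one]

/-! ### The fractional kernel and its potentials -/

lemma kernel_of_pos {n : ℕ} (α : ℝ) (x : EuclideanSpace ℝ (Fin n)) {t : ℝ} (ht : 0 < t) :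
    kernel n α x t = t ^ (α - 1) / Real.Gamma α * heat n x t := by
  rw [kernel, if_pos ht, heat, mul_assoc]

lemma kernel_of_nonpos {n : ℕ} (α : ℝ) (x : EuclideanSpace ℝ (Fin n)) {t : ℝ} (ht : t ≤ 0) :
    kernel n α x t = 0 := by
  rw [kernel, if_neg ht.not_gt]

lemma kernel_nonneg {n : ℕ} {α : ℝ} (hα : 0 < α) (x : EuclideanSpace ℝ (Fin n)) (t : ℝ) :
    0 ≤ kernel n α x t := by
  have := Real.Gamma_pos_of_pos hα
  unfold kernel
  split_ifs
  · positivity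
  · rfl

lemma measurable_kernel (n : ℕ) (α : ℝ) :
    Measurable (fun p : SpaceTime n => kernel n α p.1 p.2) := by
  unfold kernel
  refine Measurable.ite (measurableSet_lt measurable_const measurable_snd) ?_ measurable_const
  fun_prop

/-- The potential `J_α g` of a function with values in `[0, ∞]`. -/
noncomputable def pot (n : ℕ) (α : ℝ) (g : SpaceTime n → ENNReal) (z : SpaceTime n) : ENNReal :=
  ∫⁻ w, ENNReal.ofReal (kernel n α (z.1 - w.1) (z.2 - w.2)) * g w

lemma measurable_ofReal_kernel_sub (n : ℕ) (α : ℝ) :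
    Measurable (fun p : SpaceTime n × SpaceTime n =>
      ENNReal.ofReal (kernel n α (p.1.1 - p.2.1) (p.1.2 - p.2.2))) :=
  ENNReal.measurable_ofReal.comp ((measurable_kernel n α).comp
    (g := fun p : SpaceTime n => kernel n α p.1 p.2)
    (f := fun p : SpaceTime n × SpaceTime n => p.1 - p.2) (by fun_prop))

lemma measurableSet_past (n : ℕ) (T : ℝ) : MeasurableSet (past n T) :=
  MeasurableSet.univ.prod measurableSet_Iio

/-- Where the potential is infinite both sides take the default value `0`. Hence the need for
finiteness almost everywhere, shown in `ae_pot_lt_top`. -/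
lemma J_eq_toReal_pot {n : ℕ} {α : ℝ} (hα : 0 < α) {f : SpaceTime n → ℝ} (hf : f ∈ X n 1)
    (h0 : ∀ᵐ z, 0 ≤ f z) (z : SpaceTime n) :
    J n α f z = (pot n α (fun w => ENNReal.ofReal (f w)) z).toReal := by
  have hk : Measurable (fun w : SpaceTime n => kernel n α (z.1 - w.1) (z.2 - w.2)) :=
    (measurable_kernel n α).comp (g := fun p : SpaceTime n => kernel n α p.1 p.2)
      (f := fun w => z - w) (by fun_prop)
  unfold J pot
  rw [integral_eq_lintegral_of_nonneg_ae]
  · congr 1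
    rw [← lintegral_indicator (measurableSet_past n z.2)]
    refine lintegral_congr fun w => ?_
    by_cases hw : w ∈ past n z.2
    · rw [indicator_of_mem hw, ENNReal.ofReal_mul (kernel_nonneg hα _ _)]
    · rw [indicator_of_notMem hw, kernel_of_nonpos, ENNReal.ofReal_zero, zero_mul]
      simpa [past] using hw
  · filter_upwards [ae_restrict_of_ae h0] with w hw
    exact mul_nonneg (kernel_nonneg hα _ _) hw
  · exact hk.aestronglyMeasurable.mul (hf z.2).1

lemma pot_congr {n : ℕ} {α : ℝ} {g g' : SpaceTime n → ENNReal} (h : g =ᵐ[volume] g') :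
    pot n α g = pot n α g' := by
  funext z
  refine lintegral_congr_ae ?_
  filter_upwards [h] with w hw
  rw [hw]

lemma lintegral_rpow_Ioo {α : ℝ} (hα : 0 < α) {T : ℝ} (hT : 0 ≤ T) :
    ∫⁻ t in Ioo 0 T, ENNReal.ofReal (t ^ (α - 1)) = ENNReal.ofReal (T ^ α / α) := by
  have hi : IntegrableOn (fun t : ℝ => t ^ (α - 1)) (Ioc 0 T) :=
    (intervalIntegrable_iff_integrableOn_Ioc_of_le hT).1
      (intervalIntegral.intervalIntegrable_rpow' (by linarith))
  rw [setLIntegral_congr Ioo_ae_eq_Ioc, ← ofReal_integral_eq_lintegral_ofReal hi,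
    ← intervalIntegral.integral_of_le hT, integral_rpow (Or.inl (by linarith))]
  · congr 1
    rw [sub_add_cancel, Real.zero_rpow hα.ne', sub_zero]
  · filter_upwards [ae_restrict_mem measurableSet_Ioc] with t ht
    exact Real.rpow_nonneg ht.1.le _

lemma lintegral_kernel_lt_top {n : ℕ} {α : ℝ} (hα : 0 < α) :
    ∫⁻ z : SpaceTime n, (if z.2 < 1 then ENNReal.ofReal (kernel n α z.1 z.2) else 0) < ⊤ := by
  have hΓ := Real.Gamma_pos_of_pos hα
  have hm : Measurable (fun z : SpaceTime n =>
      if z.2 < 1 then ENNReal.ofReal (kernel n α z.1 z.2) else 0) :=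
    Measurable.ite (measurableSet_lt measurable_snd measurable_const)
      (ENNReal.measurable_ofReal.comp (measurable_kernel n α)) measurable_const
  rw [Measure.volume_eq_prod, lintegral_prod_symm _ hm.aemeasurable]
  have h : ∀ t : ℝ, ∫⁻ x : EuclideanSpace ℝ (Fin n),
      (if t < 1 then ENNReal.ofReal (kernel n α x t) else 0) =
      (Ioo 0 1).indicator
        (fun t => ENNReal.ofReal (1 / Real.Gamma α) * ENNReal.ofReal (t ^ (α - 1))) t := by
    intro t
    by_cases ht : t ∈ Ioo (0 : ℝ) 1
    · have := Real.rpow_nonneg ht.1.le (α - 1)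
      rw [indicator_of_mem ht]
      simp_rw [if_pos ht.2, kernel_of_pos α _ ht.1]
      simp_rw [ENNReal.ofReal_mul (div_nonneg this hΓ.le)]
      rw [lintegral_const_mul' _ _ ENNReal.ofReal_ne_top, lintegral_heat ht.1, mul_one,
        ← ENNReal.ofReal_mul (by positivity)]
      congr 1
      ring
    · rw [indicator_of_notMem ht]
      have : ∀ x : EuclideanSpace ℝ (Fin n),
          (if t < 1 then ENNReal.ofReal (kernel n α x t) else 0) = 0 := by
        intro x
        split_ifs with h1
        · rw [kernel_of_nonpos, ENNReal.ofReal_zero]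
          by_contra h2
          exact ht ⟨not_le.1 h2, h1⟩
        · rfl
      simp [this]
  simp_rw [h]
  rw [lintegral_indicator measurableSet_Ioo, lintegral_const_mul' _ _ ENNReal.ofReal_ne_top,
    lintegral_rpow_Ioo hα zero_le_one]
  exact ENNReal.mul_lt_top ENNReal.ofReal_lt_top ENNReal.ofReal_lt_top

/-- The kernel decays like `t^(α-1-n/2)`, and the exponent is nonpositive exactly when `α ≤
(n+2)/2`. -/
lemma kernel_le_of_one_le {n : ℕ} {α : ℝ} (hα : 0 < α) (hαn : α ≤ ((n : ℝ) + 2) / 2)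
    (x : EuclideanSpace ℝ (Fin n)) {t : ℝ} (ht : 1 ≤ t) :
    kernel n α x t ≤ 1 / Real.Gamma α := by
  have hΓ := Real.Gamma_pos_of_pos hα
  have ht0 : 0 < t := by linarith
  rw [kernel_of_pos α x ht0]
  calc _ ≤ t ^ (α - 1) / Real.Gamma α * t ^ (-((n : ℝ) / 2)) := by
        gcongr
        exact heat_le x ht0
    _ = t ^ (α - 1 - (n : ℝ) / 2) / Real.Gamma α := by
      rw [sub_eq_add_neg (α - 1), Real.rpow_add ht0]
      ring
    _ ≤ _ := by
      gcongr
      exact Real.rpow_le_one_of_one_le_of_nonpos ht (by linarith)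

/-- Split the kernel at time lag `1`. The near part is integrable, so its convolution with an
integrable function is finite a.e. by Tonelli; the far part is bounded. -/
lemma ae_pot_lt_top {n : ℕ} {α : ℝ} (hα : 0 < α) (hαn : α ≤ ((n : ℝ) + 2) / 2)
    {g : SpaceTime n → ENNReal} (hg : Measurable g)
    (hfin : ∀ T : ℝ, ∫⁻ w in past n T, g w < ⊤) : ∀ᵐ z, pot n α g z < ⊤ := by
  suffices h : ∀ N : ℕ, ∀ᵐ z : SpaceTime n, z.2 ≤ N → pot n α g z < ⊤ by
    filter_upwards [ae_all_iff.2 h] with z hz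
    obtain ⟨N, hN⟩ := exists_nat_ge z.2
    exact hz N hN
  intro N
  set gN := (past n N).indicator g
  have hgN : Measurable gN := hg.indicator (measurableSet_past n N)
  have hgNfin : ∫⁻ w, gN w < ⊤ := by
    rw [lintegral_indicator (measurableSet_past n N)]
    exact hfin N
  set k : SpaceTime n → ENNReal :=
    fun z => if z.2 < 1 then ENNReal.ofReal (kernel n α z.1 z.2) else 0
  have hk : Measurable k :=
    Measurable.ite (measurableSet_lt measurable_snd measurable_const)
      (ENNReal.measurable_ofReal.comp (measurable_kernel n α)) measurable_const
  have hkm : Measurable (fun p : SpaceTime n × SpaceTime n => k (p.1 - p.2) * gN p.2) :=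
    (hk.comp (by fun_prop)).mul (hgN.comp measurable_snd)
  have hint : ∫⁻ z, ∫⁻ w, k (z - w) * gN w ≠ ⊤ := by
    rw [lintegral_lintegral_swap hkm.aemeasurable]
    have : ∀ w, ∫⁻ z, k (z - w) * gN w = (∫⁻ z, k z) * gN w := by
      intro w
      have : (volume : Measure (SpaceTime n)).IsAddRightInvariant := by
        rw [Measure.volume_eq_prod]
        infer_instance
      rw [lintegral_mul_const (f := fun z => k (z - w)) _ (hk.comp (by fun_prop)), lintegral_sub_right_eq_self]
    simp_rw [this]
    rw [lintegral_const_mul _ hgN]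
    exact (ENNReal.mul_lt_top (lintegral_kernel_lt_top hα) hgNfin).ne
  filter_upwards [ae_lt_top hkm.lintegral_prod_right' hint] with z hz hzN
  calc pot n α g z ≤ ∫⁻ w, (k (z - w) * gN w + ENNReal.ofReal (1 / Real.Gamma α) * gN w) := by
        refine lintegral_mono fun w => ?_
        by_cases hw : w.2 < z.2
        · have hwN : gN w = g w := indicator_of_mem (by simpa [past] using hw.trans_le hzN) _
          rw [hwN, ← add_mul]
          gcongr
          by_cases h1 : z.2 - w.2 < 1
          · have : k (z - w) = ENNReal.ofReal (kernel n α (z.1 - w.1) (z.2 - w.2)) := if_pos h1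
            rw [this]
            exact le_self_add
          · exact (ENNReal.ofReal_le_ofReal
              (kernel_le_of_one_le hα hαn _ (not_lt.1 h1))).trans le_add_self
        · rw [kernel_of_nonpos α _ (by linarith), ENNReal.ofReal_zero, zero_mul]
          exact zero_le
    _ = (∫⁻ w, k (z - w) * gN w) + ENNReal.ofReal (1 / Real.Gamma α) * ∫⁻ w, gN w := by
        rw [lintegral_add_right _ (hgN.const_mul _), lintegral_const_mul _ hgN]
    _ < ⊤ := ENNReal.add_lt_top.2 ⟨hz, ENNReal.mul_lt_top ENNReal.ofReal_lt_top hgNfin⟩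

lemma aemeasurable_of_mem_X {n : ℕ} {f : SpaceTime n → ℝ} (hf : f ∈ X n 1) :
    AEMeasurable f volume := by
  have h : AEMeasurable f (volume.restrict (⋃ N : ℕ, past n N)) :=
    aemeasurable_iUnion_iff.2 fun N => (hf N).1.aemeasurable
  have hU : (⋃ N : ℕ, past n N) = univ := by
    refine eq_univ_of_forall fun z => mem_iUnion.2 ?_
    obtain ⟨N, hN⟩ := exists_nat_gt z.2
    exact ⟨N, by simpa [past] using hN⟩
  rwa [hU, Measure.restrict_univ] at h

/-- A function `f ∈ X^1` that is nonnegative is represented by a measurable `[0, ∞]`-valued function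
with an a.e. finite potential. -/
lemma exists_measurable_rep {n : ℕ} {α : ℝ} (hα : 0 < α) (hαn : α ≤ ((n : ℝ) + 2) / 2)
    {f : SpaceTime n → ℝ} (hf : f ∈ X n 1) (h0 : ∀ᵐ z, 0 ≤ f z) :
    ∃ g : SpaceTime n → ENNReal, Measurable g ∧ (fun z => ENNReal.ofReal (f z)) =ᵐ[volume] g ∧
      (∀ T : ℝ, ∫⁻ w in past n T, g w < ⊤) ∧ (∀ᵐ z, pot n α g z < ⊤) ∧
      ∀ z, J n α f z = (pot n α g z).toReal := by
  have hm : AEMeasurable (fun z => ENNReal.ofReal (f z)) volume :=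
    (aemeasurable_of_mem_X hf).ennreal_ofReal
  have hfin : ∀ T : ℝ, ∫⁻ w in past n T, hm.mk _ w < ⊤ := by
    intro T
    rw [← lintegral_congr_ae (ae_restrict_of_ae hm.ae_eq_mk)]
    exact (memLp_one_iff_integrable.1 (hf T)).lintegral_lt_top
  refine ⟨hm.mk _, hm.measurable_mk, hm.ae_eq_mk, hfin,
    ae_pot_lt_top hα hαn hm.measurable_mk hfin, fun z => ?_⟩
  rw [J_eq_toReal_pot hα hf h0, pot_congr hm.ae_eq_mk]

/-! ### The a priori bound from test functions -/

/-- A crude Young inequality: either `y ≤ K`, or `(y/K)^(λ-1) ≥ 1`. -/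
lemma le_const_add_rpow {lam K : ℝ} (hlam : 1 < lam) (hK : 0 < K) (y : ENNReal) :
    y ≤ ENNReal.ofReal K + ENNReal.ofReal (K ^ (1 - lam)) * y ^ lam := by
  have hK' : 0 < K ^ (1 - lam) := Real.rpow_pos_of_pos hK _
  rcases eq_or_ne y ⊤ with rfl | hy
  · rw [ENNReal.top_rpow_of_pos (by linarith), ENNReal.mul_top (by simpa using hK')]
    simp
  lift y to NNReal using hy
  rw [← ENNReal.coe_rpow_of_nonneg _ (by linarith), ← ENNReal.ofReal_coe_nnreal,
    ← ENNReal.ofReal_coe_nnreal, ← ENNReal.ofReal_mul hK'.le, NNReal.coe_rpow,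
    ← ENNReal.ofReal_add hK.le (by positivity)]
  apply ENNReal.ofReal_le_ofReal
  rcases le_or_gt (y : ℝ) K with h | h
  · have : 0 ≤ K ^ (1 - lam) * (y : ℝ) ^ lam := by positivity
    linarith
  · have hy0 : 0 < (y : ℝ) := hK.trans h
    have h1 : K ^ (lam - 1) ≤ (y : ℝ) ^ (lam - 1) :=
      Real.rpow_le_rpow hK.le h.le (by linarith)
    have h2 : (y : ℝ) ^ lam = y ^ (lam - 1) * y := by
      rw [← Real.rpow_add_one hy0.ne', sub_add_cancel]
    have h3 : K ^ (1 - lam) * K ^ (lam - 1) = 1 := by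
      rw [← Real.rpow_add hK, sub_add_sub_cancel', sub_self, Real.rpow_zero]
    calc (y : ℝ) = K ^ (1 - lam) * (K ^ (lam - 1) * y) := by rw [← mul_assoc, h3, one_mul]
      _ ≤ K ^ (1 - lam) * (y : ℝ) ^ lam := by
        rw [h2]
        gcongr
      _ ≤ _ := by linarith

/-- The backward heat kernel, weighted by a power of the time left, as a test function. -/
noncomputable def testFun (n : ℕ) (β T : ℝ) (z : SpaceTime n) : ENNReal :=
  ENNReal.ofReal ((T - z.2) ^ β * heat n z.1 (2 * T - z.2))

/-- `ℝⁿ × (0, T)`. -/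
def strip (n : ℕ) (T : ℝ) : Set (SpaceTime n) := univ ×ˢ Ioo 0 T

lemma measurableSet_strip (n : ℕ) (T : ℝ) : MeasurableSet (strip n T) :=
  MeasurableSet.univ.prod measurableSet_Ioo

lemma measurable_testFun (n : ℕ) (β T : ℝ) : Measurable (testFun n β T) := by
  refine ENNReal.measurable_ofReal.comp (Measurable.mul (by fun_prop) ?_)
  exact (measurable_heat n).comp (g := fun p : SpaceTime n => heat n p.1 p.2)
    (f := fun z : SpaceTime n => (z.1, 2 * T - z.2)) (by fun_prop)

/-- In this window `t - τ` and `T - t` are both comparable to `T - τ`. The minimum `d` covers both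
signs of `α - 1`. -/
lemma exists_le_time_factor {α β : ℝ} (hα : 0 < α) (hβ : 0 ≤ β) :
    ∃ c : ℝ, 0 < c ∧ ∀ τ T t : ℝ, τ < T → t ∈ Ioo (τ + (T - τ) / 4) (τ + (T - τ) / 2) →
      c * (T - τ) ^ (α - 1 + β) ≤ (t - τ) ^ (α - 1) / Real.Gamma α * (T - t) ^ β := by
  have hΓ := Real.Gamma_pos_of_pos hα
  set d : ℝ := min ((1 / 4) ^ (α - 1)) ((1 / 2) ^ (α - 1))
  have hd : 0 < d := lt_min (by positivity) (by positivity)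
  refine ⟨d / Real.Gamma α * (1 / 2) ^ β, by positivity, fun τ T t hτ ht => ?_⟩
  have hS : 0 < T - τ := sub_pos.2 hτ
  obtain ⟨h1, h2⟩ := ht
  have ht0 : 0 < t - τ := by linarith
  have e1 : d * (T - τ) ^ (α - 1) ≤ (t - τ) ^ (α - 1) := by
    rcases le_total 0 (α - 1) with h | h
    · calc d * (T - τ) ^ (α - 1) ≤ (1 / 4) ^ (α - 1) * (T - τ) ^ (α - 1) := by
            gcongr
            exact min_le_left _ _
        _ = (1 / 4 * (T - τ)) ^ (α - 1) := by rw [Real.mul_rpow (by norm_num) hS.le]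
        _ ≤ _ := Real.rpow_le_rpow (by positivity) (by linarith) h
    · calc d * (T - τ) ^ (α - 1) ≤ (1 / 2) ^ (α - 1) * (T - τ) ^ (α - 1) := by
            gcongr
            exact min_le_right _ _
        _ = (1 / 2 * (T - τ)) ^ (α - 1) := by rw [Real.mul_rpow (by norm_num) hS.le]
        _ ≤ _ := Real.rpow_le_rpow_of_nonpos ht0 (by linarith) h
  have e2 : (1 / 2) ^ β * (T - τ) ^ β ≤ (T - t) ^ β := by
    rw [← Real.mul_rpow (by norm_num) hS.le]
    exact Real.rpow_le_rpow (by positivity) (by linarith) hβ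
  rw [Real.rpow_add hS]
  calc _ = (d * (T - τ) ^ (α - 1)) / Real.Gamma α * ((1 / 2) ^ β * (T - τ) ^ β) := by ring
    _ ≤ _ := by gcongr

/-- The adjoint of `J_α` maps the test function of order `β` to one of order `α + β`. -/
lemma exists_le_adjoint_testFun (n : ℕ) {α β : ℝ} (hα : 0 < α) (hβ : 0 ≤ β) :
    ∃ c : ℝ, 0 < c ∧ ∀ T : ℝ, ∀ w ∈ strip n T, ENNReal.ofReal c * testFun n (α + β) T w ≤
      ∫⁻ z in strip n T, ENNReal.ofReal (kernel n α (z.1 - w.1) (z.2 - w.2)) * testFun n β T z := by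
  have hΓ := Real.Gamma_pos_of_pos hα
  obtain ⟨c, hc, H⟩ := exists_le_time_factor hα hβ
  refine ⟨c / 4, by positivity, fun T w hw => ?_⟩
  obtain ⟨-, hw0, hwT⟩ := hw
  have hS : 0 < T - w.2 := sub_pos.2 hwT
  set I := Ioo (w.2 + (T - w.2) / 4) (w.2 + (T - w.2) / 2)
  have hh : 0 < heat n w.1 (2 * T - w.2) := heat_pos _ (by linarith)
  have hm : Measurable fun z : SpaceTime n =>
      ENNReal.ofReal (kernel n α (z.1 - w.1) (z.2 - w.2)) * testFun n β T z :=
    ((measurable_ofReal_kernel_sub n α).comp (measurable_id.prodMk measurable_const)).mul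
      (measurable_testFun n β T)
  -- The times `t - w.2` and `2T - t` add up to `2T - w.2` whatever `t` is, so the `x`-integral
  -- reproduces the same backward heat kernel. The length `(T - w.2)/4` of `I` then supplies the
  -- missing power of `T - w.2` and the factor `1/4`.
  have key : ∀ t ∈ I, ENNReal.ofReal (c * (T - w.2) ^ (α - 1 + β) * heat n w.1 (2 * T - w.2)) ≤
      ∫⁻ x, ENNReal.ofReal (kernel n α (x - w.1) (t - w.2)) * testFun n β T (x, t) := by
    intro t ht
    have ht0 : 0 < t - w.2 := by linarith [ht.1]
    have htT : 0 < T - t := by linarith [ht.2]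
    have e : ∀ x, ENNReal.ofReal (kernel n α (x - w.1) (t - w.2)) * testFun n β T (x, t) =
        ENNReal.ofReal ((t - w.2) ^ (α - 1) / Real.Gamma α * (T - t) ^ β) *
          ENNReal.ofReal (heat n (w.1 - x) (t - w.2) * heat n x (2 * T - t)) := by
      intro x
      rw [testFun, ← ENNReal.ofReal_mul (kernel_nonneg hα _ _), ← ENNReal.ofReal_mul (by positivity),
        kernel_of_pos α _ ht0, ← heat_neg (w.1 - x), neg_sub]
      congr 1
      ring
    simp_rw [e]
    rw [lintegral_const_mul' _ _ ENNReal.ofReal_ne_top,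
      lintegral_heat_mul_heat _ ht0 (by linarith), ← ENNReal.ofReal_mul (by positivity),
      show t - w.2 + (2 * T - t) = 2 * T - w.2 by ring]
    apply ENNReal.ofReal_le_ofReal
    exact mul_le_mul_of_nonneg_right (H _ _ _ hwT ht) hh.le
  have hsub : (univ ×ˢ I : Set (SpaceTime n)) ⊆ strip n T := by
    rintro z ⟨-, h1, h2⟩
    exact ⟨trivial, by linarith, by linarith⟩
  refine le_trans ?_ (lintegral_mono_set hsub)
  rw [Measure.volume_eq_prod, ← Measure.prod_restrict, Measure.restrict_univ,
    lintegral_prod_symm _ hm.aemeasurable]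
  refine le_trans ?_ (setLIntegral_mono' measurableSet_Ioo key)
  rw [setLIntegral_const, Real.volume_Ioo, ← ENNReal.ofReal_mul (by positivity), testFun,
    ← ENNReal.ofReal_mul (by positivity)]
  apply ENNReal.ofReal_le_ofReal
  rw [show α + β = α - 1 + β + 1 by ring, Real.rpow_add_one hS.ne']
  linarith

lemma lintegral_strip_heat (n : ℕ) {T : ℝ} (hT : 0 < T) :
    ∫⁻ z in strip n T, ENNReal.ofReal (heat n z.1 (2 * T - z.2)) = ENNReal.ofReal T := by
  have hm : Measurable fun z : SpaceTime n => ENNReal.ofReal (heat n z.1 (2 * T - z.2)) :=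
    ENNReal.measurable_ofReal.comp ((measurable_heat n).comp
      (g := fun p : SpaceTime n => heat n p.1 p.2)
      (f := fun z : SpaceTime n => (z.1, 2 * T - z.2)) (by fun_prop))
  rw [strip, Measure.volume_eq_prod, ← Measure.prod_restrict, Measure.restrict_univ,
    lintegral_prod_symm _ hm.aemeasurable]
  have : ∀ t ∈ Ioo 0 T, ∫⁻ x, ENNReal.ofReal (heat n x (2 * T - t)) = 1 :=
    fun t ht => lintegral_heat (by linarith [ht.2])
  rw [setLIntegral_congr_fun measurableSet_Ioo this]
  simp

/-- Testing the inequality `(J_α g)^λ ≤ g` with the weighted backward heat kernel. -/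
lemma exists_lintegral_testFun_le {n : ℕ} {α lam : ℝ} (hα : 0 < α) (hlam : 1 < lam)
    {g : SpaceTime n → ENNReal} (hg : Measurable g)
    (hfin : ∀ T : ℝ, ∫⁻ w in past n T, g w < ⊤) (hsup : ∀ᵐ z, pot n α g z ^ lam ≤ g z) :
    ∃ C : ℝ, 0 ≤ C ∧ ∀ T : ℝ, 1 ≤ T →
      ∫⁻ w in strip n T, testFun n (α + α / (lam - 1)) T w * g w ≤ ENNReal.ofReal (C * T) := by
  have hl : 0 < lam - 1 := by linarith
  -- Chosen so that the `λ`-th power of `(T-t)^β` is `(T-t)^(α+β)`.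
  set β := α / (lam - 1) with hβdef
  have hβ : 0 < β := by positivity
  have hβl : β * lam = α + β := by
    rw [hβdef]
    field_simp
    ring
  obtain ⟨c, hc, H⟩ := exists_le_adjoint_testFun n hα hβ.le
  -- Makes the coefficient of the nonlinear term `c/2`, half of what the lower bound provides.
  set K := (c / 2) ^ (1 / (1 - lam)) with hKdef
  have hK : 0 < K := by positivity
  have hKl : K ^ (1 - lam) = c / 2 := by
    rw [hKdef, ← Real.rpow_mul (by positivity), one_div_mul_cancel (by linarith), Real.rpow_one]
  refine ⟨2 * K / c, by positivity, fun T hT => ?_⟩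
  have hT0 : 0 < T := by linarith
  set F := ∫⁻ w in strip n T, testFun n (α + β) T w * g w with hF
  have hm1 : Measurable fun w => testFun n (α + β) T w * g w := (measurable_testFun _ _ _).mul hg
  have hFfin : F < ⊤ := by
    calc F ≤ ∫⁻ w in strip n T, ENNReal.ofReal (T ^ (α + β)) * g w := by
          refine setLIntegral_mono (hg.const_mul _) fun w hw => ?_
          obtain ⟨-, h1, h2⟩ := hw
          gcongr
          apply ENNReal.ofReal_le_ofReal
          calc _ ≤ T ^ (α + β) * 1 := by
                gcongr
                · exact (heat_pos _ (by linarith)).le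
                · linarith
                · refine (heat_le _ (by linarith)).trans ?_
                  exact Real.rpow_le_one_of_one_le_of_nonpos (by linarith)
                    (by simp only [neg_nonpos]; positivity)
            _ = _ := mul_one _
      _ ≤ ENNReal.ofReal (T ^ (α + β)) * ∫⁻ w in past n T, g w := by
          rw [lintegral_const_mul _ hg]
          gcongr
          exact fun z hz => ⟨trivial, hz.2.2⟩
      _ < ⊤ := ENNReal.mul_lt_top ENNReal.ofReal_lt_top (hfin T)
  have hmk : Measurable fun p : SpaceTime n × SpaceTime n =>
      ENNReal.ofReal (kernel n α (p.1.1 - p.2.1) (p.1.2 - p.2.2)) * testFun n β T p.1 * g p.2 :=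
    ((measurable_ofReal_kernel_sub n α).mul ((measurable_testFun n β T).comp measurable_fst)).mul
      (hg.comp measurable_snd)
  have lower : ENNReal.ofReal c * F ≤ ∫⁻ z in strip n T, pot n α g z * testFun n β T z := by
    calc ENNReal.ofReal c * F = ∫⁻ w in strip n T, ENNReal.ofReal c * testFun n (α + β) T w * g w := by
          simp_rw [mul_assoc]
          rw [lintegral_const_mul _ hm1]
      _ ≤ ∫⁻ w in strip n T, ∫⁻ z in strip n T,
            ENNReal.ofReal (kernel n α (z.1 - w.1) (z.2 - w.2)) * testFun n β T z * g w := by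
          refine setLIntegral_mono' (measurableSet_strip n T) fun w hw => ?_
          rw [lintegral_mul_const]
          · gcongr
            exact H T w hw
          · exact ((measurable_ofReal_kernel_sub n α).comp
              (measurable_id.prodMk measurable_const)).mul (measurable_testFun n β T)
      _ ≤ ∫⁻ w, ∫⁻ z in strip n T,
            ENNReal.ofReal (kernel n α (z.1 - w.1) (z.2 - w.2)) * testFun n β T z * g w :=
          setLIntegral_le_lintegral _ _
      _ = ∫⁻ z in strip n T, ∫⁻ w,
            ENNReal.ofReal (kernel n α (z.1 - w.1) (z.2 - w.2)) * testFun n β T z * g w :=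
          (lintegral_lintegral_swap hmk.aemeasurable).symm
      _ = _ := by
          refine lintegral_congr fun z => ?_
          rw [pot, ← lintegral_mul_const]
          · refine lintegral_congr fun w => ?_
            ring
          · exact ((measurable_ofReal_kernel_sub n α).comp
              (measurable_const.prodMk measurable_id)).mul hg
  have upper : ∫⁻ z in strip n T, pot n α g z * testFun n β T z ≤
      ENNReal.ofReal (K * T) + ENNReal.ofReal (c / 2) * F := by
    calc _ ≤ ∫⁻ z in strip n T, (ENNReal.ofReal K * ENNReal.ofReal (heat n z.1 (2 * T - z.2)) +
            ENNReal.ofReal (c / 2) * (testFun n (α + β) T z * g z)) := by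
          refine lintegral_mono_ae ?_
          filter_upwards [ae_restrict_of_ae hsup, ae_restrict_mem (measurableSet_strip n T)]
            with z hz hzs
          obtain ⟨-, h1, h2⟩ := hzs
          have hs : 0 < T - z.2 := by linarith
          have hyoung := le_const_add_rpow hlam hK
            (pot n α g z * ENNReal.ofReal ((T - z.2) ^ β))
          rw [hKl, ENNReal.mul_rpow_of_nonneg _ _ (by linarith),
            ENNReal.ofReal_rpow_of_nonneg (by positivity) (by linarith),
            ← Real.rpow_mul hs.le, hβl] at hyoung
          simp only [testFun]
          rw [ENNReal.ofReal_mul (by positivity), ENNReal.ofReal_mul (by positivity), ← mul_assoc]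
          calc _ ≤ (ENNReal.ofReal K + ENNReal.ofReal (c / 2) *
                (pot n α g z ^ lam * ENNReal.ofReal ((T - z.2) ^ (α + β)))) *
                ENNReal.ofReal (heat n z.1 (2 * T - z.2)) := by gcongr
            _ ≤ (ENNReal.ofReal K + ENNReal.ofReal (c / 2) *
                (g z * ENNReal.ofReal ((T - z.2) ^ (α + β)))) *
                ENNReal.ofReal (heat n z.1 (2 * T - z.2)) := by gcongr
            _ = _ := by ring
      _ = _ := by
          rw [lintegral_add_right _ (hm1.const_mul _), lintegral_const_mul _ hm1,
            lintegral_const_mul' _ _ ENNReal.ofReal_ne_top, lintegral_strip_heat n hT0,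
            ← ENNReal.ofReal_mul hK.le]
  -- Now `c F ≤ K T + (c/2) F`, and `F` is finite, so the last term can be absorbed.
  have hle := lower.trans upper
  rw [← ENNReal.ofReal_toReal hFfin.ne, ← ENNReal.ofReal_mul hc.le,
    ← ENNReal.ofReal_mul (by positivity),
    ← ENNReal.ofReal_add (by positivity) (by positivity),
    ENNReal.ofReal_le_ofReal_iff (by positivity)] at hle
  rw [← ENNReal.ofReal_toReal hFfin.ne]
  apply ENNReal.ofReal_le_ofReal
  rw [div_mul_eq_mul_div, le_div_iff₀ hc]
  linarith

/-! ### Lower bound on a paraboloid and nonexistence -/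

lemma exists_lintegral_closedBall_ne_zero {n : ℕ} {g : SpaceTime n → ENNReal} (hg : Measurable g)
    (hg0 : ¬ g =ᵐ[volume] 0) : ∃ N : ℕ, ∫⁻ w in Metric.closedBall 0 N, g w ≠ 0 := by
  by_contra! h
  apply hg0
  have h1 : ∀ N : ℕ, ∀ᵐ w ∂(volume.restrict (Metric.closedBall (0 : SpaceTime n) N)), g w = 0 :=
    fun N => (lintegral_eq_zero_iff hg).1 (h N)
  have h2 := (ae_restrict_iUnion_iff (μ := volume) _ _).2 h1
  rwa [Metric.iUnion_closedBall_nat, Measure.restrict_univ] at h2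

/-- Lower bound for a nontrivial potential on a paraboloid. -/
lemma exists_le_pot {n : ℕ} {α : ℝ} (hα : 0 < α) (hαn : α ≤ ((n : ℝ) + 2) / 2)
    {g : SpaceTime n → ENNReal} (hg : Measurable g) (hg0 : ¬ g =ᵐ[volume] 0) :
    ∃ c t₀ : ℝ, 0 < c ∧ 1 ≤ t₀ ∧ ∀ z : SpaceTime n, t₀ ≤ z.2 → ‖z.1‖ ^ 2 ≤ z.2 →
      ENNReal.ofReal (c * z.2 ^ (-(((n : ℝ) + 2) / 2 - α))) ≤ pot n α g z := by
  have hΓ := Real.Gamma_pos_of_pos hα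
  obtain ⟨N, hN⟩ := exists_lintegral_closedBall_ne_zero hg hg0
  set B := Metric.closedBall (0 : SpaceTime n) N
  set m := ∫⁻ w in B, g w
  -- The mass of `g` on the ball may be infinite here; truncation gives a positive real constant.
  set m' := (min m 1).toReal
  have hmtop : min m 1 ≠ ⊤ := by simp
  have hm' : 0 < m' := ENNReal.toReal_pos (by simp [hN]) hmtop
  have hmm : ENNReal.ofReal m' ≤ m := by
    rw [ENNReal.ofReal_toReal hmtop]
    exact min_le_left _ _
  set e := -(((n : ℝ) + 2) / 2 - α) with he
  have he0 : e ≤ 0 := by linarith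
  set d := 1 / Real.Gamma α * ((4 * Real.pi) ^ (-((n : ℝ) / 2)) * Real.exp (-2)) * 2 ^ e
  have hd : 0 < d := by positivity
  -- For `t` beyond this threshold, `N ≤ t/2` and `N² ≤ t/2`. So the time lag to any point of the
  -- ball lies in `[t/2, 2t]`, and the Gaussian exponent stays above `-2`.
  refine ⟨d * m', 2 * ((N : ℝ) + 1) ^ 2, by positivity, by nlinarith [N.cast_nonneg (α := ℝ)],
    fun z hz hx => ?_⟩
  have hN0 : (0 : ℝ) ≤ N := N.cast_nonneg
  have ht : 0 < z.2 := by nlinarith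
  have key : ∀ w ∈ B, ENNReal.ofReal (d * z.2 ^ e) * g w ≤
      ENNReal.ofReal (kernel n α (z.1 - w.1) (z.2 - w.2)) * g w := by
    intro w hw
    rw [mem_closedBall_zero_iff, Prod.norm_def, max_le_iff, Real.norm_eq_abs, abs_le] at hw
    obtain ⟨hw1, hw2, hw3⟩ := hw
    have hs1 : z.2 / 2 ≤ z.2 - w.2 := by nlinarith
    have hs2 : z.2 - w.2 ≤ 2 * z.2 := by nlinarith
    have hs : 0 < z.2 - w.2 := by linarith
    gcongr
    rw [kernel_of_pos α _ hs]
    have hnorm : ‖z.1 - w.1‖ ^ 2 ≤ 8 * (z.2 - w.2) := by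
      have h1 : ‖z.1 - w.1‖ ≤ ‖z.1‖ + N := (norm_sub_le _ _).trans (by linarith)
      have h2 : ‖z.1 - w.1‖ ^ 2 ≤ (‖z.1‖ + N) ^ 2 := by gcongr
      nlinarith [sq_nonneg (‖z.1‖ - N)]
    calc d * z.2 ^ e = 1 / Real.Gamma α * ((4 * Real.pi) ^ (-((n : ℝ) / 2)) * Real.exp (-2)) *
          (2 * z.2) ^ e := by
          rw [Real.mul_rpow (by norm_num) ht.le]
          ring
      _ ≤ 1 / Real.Gamma α * ((4 * Real.pi) ^ (-((n : ℝ) / 2)) * Real.exp (-2)) *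
          (z.2 - w.2) ^ e := by
          gcongr ?_ * ?_
          exact Real.rpow_le_rpow_of_nonpos hs hs2 he0
      _ = (z.2 - w.2) ^ (α - 1) / Real.Gamma α *
          ((4 * Real.pi) ^ (-((n : ℝ) / 2)) * Real.exp (-2) * (z.2 - w.2) ^ (-((n : ℝ) / 2))) := by
          rw [he, show -(((n : ℝ) + 2) / 2 - α) = (α - 1) + (-((n : ℝ) / 2)) by ring,
            Real.rpow_add hs]
          ring
      _ ≤ _ := by
          gcongr
          exact le_heat _ hs le_rfl hnorm
  calc ENNReal.ofReal (d * m' * z.2 ^ e) = ENNReal.ofReal (d * z.2 ^ e) * ENNReal.ofReal m' := by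
        rw [← ENNReal.ofReal_mul (by positivity)]
        congr 1
        ring
    _ ≤ ENNReal.ofReal (d * z.2 ^ e) * ∫⁻ w in B, g w := by gcongr
    _ = ∫⁻ w in B, ENNReal.ofReal (d * z.2 ^ e) * g w := by rw [lintegral_const_mul _ hg]
    _ ≤ ∫⁻ w in B, ENNReal.ofReal (kernel n α (z.1 - w.1) (z.2 - w.2)) * g w :=
        setLIntegral_mono' Metric.isClosed_closedBall.measurableSet key
    _ ≤ _ := setLIntegral_le_lintegral _ _

/-- A piece of the paraboloid `|x|² ≤ t`. -/
def paraboloid (n : ℕ) (a b : ℝ) : Set (SpaceTime n) := {z | ‖z.1‖ ^ 2 ≤ z.2 ∧ z.2 ∈ Ioo a b}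

lemma measurableSet_paraboloid (n : ℕ) (a b : ℝ) : MeasurableSet (paraboloid n a b) :=
  (measurableSet_le (by fun_prop) measurable_snd).inter (measurable_snd measurableSet_Ioo)

/-- The slice at time `t` is a ball of volume `t^(n/2)` times that of the unit ball, leaving `1/t`
to integrate. -/
lemma lintegral_paraboloid (n : ℕ) {a b : ℝ} (ha : 0 < a) (hab : a ≤ b) :
    ∫⁻ z in paraboloid n a b, ENNReal.ofReal (z.2 ^ (-(((n : ℝ) + 2) / 2))) =
      ENNReal.ofReal (Real.log (b / a)) *
        volume (Metric.ball (0 : EuclideanSpace ℝ (Fin n)) 1) := by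
  have hm : Measurable ((paraboloid n a b).indicator
      fun z : SpaceTime n => ENNReal.ofReal (z.2 ^ (-(((n : ℝ) + 2) / 2)))) :=
    Measurable.indicator (by fun_prop) (measurableSet_paraboloid n a b)
  rw [← lintegral_indicator (measurableSet_paraboloid n a b), Measure.volume_eq_prod,
    lintegral_prod_symm _ hm.aemeasurable]
  have h : ∀ t : ℝ, ∫⁻ x : EuclideanSpace ℝ (Fin n), (paraboloid n a b).indicator
      (fun z : SpaceTime n => ENNReal.ofReal (z.2 ^ (-(((n : ℝ) + 2) / 2)))) (x, t) =
      (Ioo a b).indicator (fun t => ENNReal.ofReal t⁻¹ *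
        volume (Metric.ball (0 : EuclideanSpace ℝ (Fin n)) 1)) t := by
    intro t
    by_cases ht : t ∈ Ioo a b
    · have ht0 : 0 < t := ha.trans ht.1
      have e : ∀ x : EuclideanSpace ℝ (Fin n), (paraboloid n a b).indicator
          (fun z : SpaceTime n => ENNReal.ofReal (z.2 ^ (-(((n : ℝ) + 2) / 2)))) (x, t) =
          (Metric.closedBall 0 (Real.sqrt t)).indicator
            (fun _ => ENNReal.ofReal (t ^ (-(((n : ℝ) + 2) / 2)))) x := by
        intro x
        have hiff : (x, t) ∈ paraboloid n a b ↔ x ∈ Metric.closedBall 0 (Real.sqrt t) := by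
          rw [mem_closedBall_zero_iff, Real.le_sqrt (norm_nonneg _) ht0.le]
          exact and_iff_left ht
        by_cases hx : x ∈ Metric.closedBall 0 (Real.sqrt t)
        · rw [indicator_of_mem (hiff.2 hx), indicator_of_mem hx]
        · rw [indicator_of_notMem (mt hiff.1 hx), indicator_of_notMem hx]
      simp_rw [e]
      rw [lintegral_indicator_const Metric.isClosed_closedBall.measurableSet,
        indicator_of_mem ht, Measure.addHaar_closedBall _ _ (Real.sqrt_nonneg t),
        finrank_euclideanSpace_fin, ← mul_assoc, ← ENNReal.ofReal_mul (by positivity)]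
      congr 2
      rw [Real.sqrt_eq_rpow, ← Real.rpow_natCast, ← Real.rpow_mul ht0.le, ← Real.rpow_add ht0,
        ← Real.rpow_neg_one]
      congr 1
      ring
    · rw [indicator_of_notMem ht]
      have e : ∀ x : EuclideanSpace ℝ (Fin n), (paraboloid n a b).indicator
          (fun z : SpaceTime n => ENNReal.ofReal (z.2 ^ (-(((n : ℝ) + 2) / 2)))) (x, t) = 0 :=
        fun x => indicator_of_notMem (fun hx => ht hx.2) _
      simp [e]
  simp_rw [h]
  rw [lintegral_indicator measurableSet_Ioo, lintegral_mul_const _ (by fun_prop)]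
  congr 1
  have h0 : (0 : ℝ) ∉ uIcc a b := by
    rw [uIcc_of_le hab]
    exact fun h => ha.not_ge h.1
  have hi : IntegrableOn (fun t : ℝ => t⁻¹) (Ioc a b) :=
    (intervalIntegrable_iff_integrableOn_Ioc_of_le hab).1
      (intervalIntegrable_inv_iff.2 (Or.inr h0))
  rw [setLIntegral_congr Ioo_ae_eq_Ioc, ← ofReal_integral_eq_lintegral_ofReal hi,
    ← intervalIntegral.integral_of_le hab, integral_inv_of_pos ha (ha.trans_le hab)]
  filter_upwards [ae_restrict_mem measurableSet_Ioc] with t ht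
  exact inv_nonneg.2 (ha.trans ht.1).le

/-- Below and at the critical exponent the inequality `(J_α g)^λ ≤ g` has only the trivial
solution. -/
lemma ae_eq_zero_of_pot_rpow_le {n : ℕ} {α lam : ℝ} (hα : 0 < α) (hαn : α ≤ ((n : ℝ) + 2) / 2)
    (hlam : 1 < lam) (hcrit : lam * (((n : ℝ) + 2) / 2 - α) ≤ ((n : ℝ) + 2) / 2)
    {g : SpaceTime n → ENNReal} (hg : Measurable g)
    (hfin : ∀ T : ℝ, ∫⁻ w in past n T, g w < ⊤) (hsup : ∀ᵐ z, pot n α g z ^ lam ≤ g z) :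
    g =ᵐ[volume] 0 := by
  by_contra hg0
  obtain ⟨C, hC, hupper⟩ := exists_lintegral_testFun_le hα hlam hg hfin hsup
  obtain ⟨c, t₀, hc, ht₀, hlower⟩ := exists_le_pot hα hαn hg hg0
  have hl : 0 < lam - 1 := by linarith
  set γ := α + α / (lam - 1) with hγdef
  -- Since `γ = λα/(λ-1)`, this is `hcrit` rearranged.
  have hγ : ((n : ℝ) + 2) / 2 ≤ γ := by
    have : γ = lam * α / (lam - 1) := by
      rw [hγdef]
      field_simp
      ring
    rw [this, le_div_iff₀ hl]
    linarith
  have hγ0 : 0 < γ := by positivity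
  set d : ℝ := (1 / 2) ^ γ *
    ((4 * Real.pi) ^ (-((n : ℝ) / 2)) * Real.exp (-2) * 2 ^ (-((n : ℝ) / 2))) with hd
  have hd0 : 0 < d := by positivity
  set b := volume (Metric.ball (0 : EuclideanSpace ℝ (Fin n)) 1)
  have hb0 : b ≠ 0 := (Metric.measure_ball_pos volume _ one_pos).ne'
  have hbtop : b ≠ ⊤ := measure_ball_lt_top.ne
  -- `L` will be the logarithmic length of the time interval `(t₀, T/2)`, just long enough to
  -- violate the a priori bound.
  set L : ℝ := C / (d * (c ^ lam * b.toReal)) + 1 with hL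
  have hbr : 0 < b.toReal := ENNReal.toReal_pos hb0 hbtop
  have hL0 : 0 < L := by positivity
  set T := 2 * (t₀ * Real.exp L) with hT
  have hexp : 1 ≤ Real.exp L := Real.one_le_exp hL0.le
  have hT1 : 1 ≤ T := by nlinarith
  have hT0 : 0 < T := by linarith
  have ht00 : 0 < t₀ := by linarith
  have hlog : Real.log (T / 2 / t₀) = L := by
    rw [hT, mul_div_cancel_left₀ _ (by norm_num : (2 : ℝ) ≠ 0), mul_div_cancel_left₀ _ ht00.ne',
      Real.log_exp]
  have hsub : paraboloid n t₀ (T / 2) ⊆ strip n T := fun z hz =>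
    ⟨trivial, ht00.trans hz.2.1, hz.2.2.trans (by linarith)⟩
  -- Here `T - t ≥ T/2` and the heat kernel is at least a multiple of `T^(-n/2)`, so the test
  -- function is at least `d T^(γ-n/2) ≥ d T`.
  have h1 : ENNReal.ofReal (d * T) * ∫⁻ z in paraboloid n t₀ (T / 2), g z ≤
      ENNReal.ofReal (C * T) := by
    refine le_trans ?_ (hupper T hT1)
    refine le_trans ?_ (lintegral_mono_set hsub)
    rw [← lintegral_const_mul _ hg]
    refine setLIntegral_mono' (measurableSet_paraboloid _ _ _) fun z hz => ?_
    obtain ⟨hz1, hz2, hz3⟩ := hz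
    gcongr
    apply ENNReal.ofReal_le_ofReal
    have hheat := le_heat (n := n) z.1 (t := 2 * T - z.2) (T := 2 * T) (by linarith) (by linarith)
      (by linarith)
    have hpow : (1 / 2 * T) ^ γ ≤ (T - z.2) ^ γ :=
      Real.rpow_le_rpow (by positivity) (by linarith) hγ0.le
    have hTpow : T ≤ T ^ (γ + -((n : ℝ) / 2)) := by
      conv_lhs => rw [← Real.rpow_one T]
      exact Real.rpow_le_rpow_of_exponent_le hT1 (by linarith)
    calc d * T ≤ d * T ^ (γ + -((n : ℝ) / 2)) := by gcongr
      _ = (1 / 2 * T) ^ γ *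
          ((4 * Real.pi) ^ (-((n : ℝ) / 2)) * Real.exp (-2) * (2 * T) ^ (-((n : ℝ) / 2))) := by
          rw [Real.rpow_add hT0, Real.mul_rpow (by norm_num) hT0.le,
            Real.mul_rpow (by norm_num) hT0.le, hd]
          ring
      _ ≤ _ := by
          gcongr
          exact Real.rpow_nonneg (by linarith) _
  have h2 : ENNReal.ofReal (c ^ lam) * (ENNReal.ofReal L * b) ≤
      ∫⁻ z in paraboloid n t₀ (T / 2), g z := by
    rw [← hlog, ← lintegral_paraboloid n ht00 (by rw [hT]; nlinarith),
      ← lintegral_const_mul _ (by fun_prop)]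
    refine lintegral_mono_ae ?_
    filter_upwards [ae_restrict_of_ae hsup, ae_restrict_mem (measurableSet_paraboloid _ _ _)]
      with z hz hzs
    obtain ⟨hz1, hz2, hz3⟩ := hzs
    have hz0 : 0 < z.2 := ht00.trans hz2
    refine le_trans ?_ hz
    refine le_trans ?_ (ENNReal.rpow_le_rpow (hlower z hz2.le hz1) (by linarith))
    rw [ENNReal.ofReal_rpow_of_nonneg (by positivity) (by linarith),
      ← ENNReal.ofReal_mul (by positivity)]
    apply ENNReal.ofReal_le_ofReal
    rw [Real.mul_rpow hc.le (by positivity), ← Real.rpow_mul hz0.le]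
    gcongr
    · linarith
    · linarith
  have h3 := (mul_le_mul_right h2 (ENNReal.ofReal (d * T))).trans h1
  rw [← ENNReal.ofReal_toReal hbtop, ← ENNReal.ofReal_mul hL0.le,
    ← ENNReal.ofReal_mul (by positivity), ← ENNReal.ofReal_mul (by positivity),
    ENNReal.ofReal_le_ofReal_iff (by positivity)] at h3
  have h4 : d * (c ^ lam * (L * b.toReal)) ≤ C := by
    refine le_of_mul_le_mul_right ?_ hT0
    linarith
  have h5 : d * (c ^ lam * (L * b.toReal)) = C + d * (c ^ lam * b.toReal) := by
    rw [hL]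
    field_simp
  have : 0 < d * (c ^ lam * b.toReal) := by positivity
  linarith

/-! ### Existence above the critical exponent -/

/-- Split at `t - τ = (1+t)/4`. For larger lags the kernel factor is at most a multiple of
`(1+t)^(α-1)`, and `(1+τ)^(-q)` is integrable. For smaller lags `1 + τ` is comparable to `1 + t`,
and the total is of order `(1+t)^(α-q)`. -/
lemma exists_lintegral_time_le {α q : ℝ} (hα : 0 < α) (hq : 1 < q) :
    ∃ C : ℝ, 0 < C ∧ ∀ t : ℝ, 0 < t →
      ∫⁻ τ in Ioo 0 t, ENNReal.ofReal ((t - τ) ^ (α - 1) / Real.Gamma α * (1 + τ) ^ (-q)) ≤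
        ENNReal.ofReal (C * (1 + t) ^ (α - 1)) := by
  have hΓ := Real.Gamma_pos_of_pos hα
  have hI : ∫⁻ τ in Ioi (0 : ℝ), ENNReal.ofReal ((1 + τ) ^ (-q)) < ⊤ := by
    have h : IntegrableOn (fun τ : ℝ => (1 + τ) ^ (-q)) (Ioi 0) := by
      have := integrableOn_add_rpow_Ioi_of_lt (a := -q) (c := 0) (m := 1) (by linarith)
        (by norm_num)
      simpa only [add_comm] using this
    exact h.lintegral_lt_top
  set A := (∫⁻ τ in Ioi (0 : ℝ), ENNReal.ofReal ((1 + τ) ^ (-q))).toReal with hA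
  have hA0 : 0 ≤ A := ENNReal.toReal_nonneg
  set D : ℝ := 1 + (1 / 4) ^ (α - 1) with hD
  have hD0 : 0 < D := by positivity
  refine ⟨D / Real.Gamma α * A + (1 / 2) ^ (-q) / Real.Gamma α / α, by positivity,
    fun t ht => ?_⟩
  have ht1 : 0 < 1 + t := by linarith
  have key : ∀ τ ∈ Ioo 0 t,
      ENNReal.ofReal ((t - τ) ^ (α - 1) / Real.Gamma α * (1 + τ) ^ (-q)) ≤
        ENNReal.ofReal (D / Real.Gamma α * (1 + t) ^ (α - 1)) * ENNReal.ofReal ((1 + τ) ^ (-q)) +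
        ENNReal.ofReal ((1 / 2) ^ (-q) / Real.Gamma α * (1 + t) ^ (-q)) *
          ENNReal.ofReal ((t - τ) ^ (α - 1)) := by
    rintro τ ⟨h0, h1⟩
    have hs : 0 < t - τ := by linarith
    have hτ : 0 < 1 + τ := by linarith
    rw [← ENNReal.ofReal_mul (by positivity), ← ENNReal.ofReal_mul (by positivity),
      ← ENNReal.ofReal_add (by positivity) (by positivity)]
    apply ENNReal.ofReal_le_ofReal
    rcases le_total ((1 + t) / 4) (t - τ) with h | h
    · have e : (t - τ) ^ (α - 1) ≤ D * (1 + t) ^ (α - 1) := by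
        have hp1 : 0 < (1 + t) ^ (α - 1) := by positivity
        have hp2 : (0 : ℝ) < (1 / 4) ^ (α - 1) := by positivity
        rcases le_total 0 (α - 1) with h' | h'
        · have : (t - τ) ^ (α - 1) ≤ (1 + t) ^ (α - 1) :=
            Real.rpow_le_rpow hs.le (by linarith) h'
          nlinarith
        · have : (t - τ) ^ (α - 1) ≤ (1 / 4 * (1 + t)) ^ (α - 1) :=
            Real.rpow_le_rpow_of_nonpos (by positivity) (by linarith) h'
          rw [Real.mul_rpow (by norm_num) ht1.le] at this
          nlinarith
      calc _ ≤ D * (1 + t) ^ (α - 1) / Real.Gamma α * (1 + τ) ^ (-q) := by gcongr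
        _ = D / Real.Gamma α * (1 + t) ^ (α - 1) * (1 + τ) ^ (-q) := by ring
        _ ≤ _ := le_add_of_nonneg_right (by positivity)
    · have e : (1 + τ) ^ (-q) ≤ (1 / 2) ^ (-q) * (1 + t) ^ (-q) := by
        rw [← Real.mul_rpow (by norm_num) ht1.le]
        exact Real.rpow_le_rpow_of_nonpos (by positivity) (by linarith) (by linarith)
      calc _ ≤ (t - τ) ^ (α - 1) / Real.Gamma α * ((1 / 2) ^ (-q) * (1 + t) ^ (-q)) := by gcongr
        _ = (1 / 2) ^ (-q) / Real.Gamma α * (1 + t) ^ (-q) * (t - τ) ^ (α - 1) := by ring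
        _ ≤ _ := le_add_of_nonneg_left (by positivity)
  have hrefl : ∫⁻ τ in Ioo 0 t, ENNReal.ofReal ((t - τ) ^ (α - 1)) = ENNReal.ofReal (t ^ α / α) := by
    rw [← lintegral_rpow_Ioo hα ht.le, ← lintegral_indicator measurableSet_Ioo,
      ← lintegral_indicator measurableSet_Ioo,
      ← lintegral_sub_left_eq_self
        ((Ioo 0 t).indicator fun τ => ENNReal.ofReal (τ ^ (α - 1))) t]
    refine lintegral_congr fun τ => ?_
    have hiff : t - τ ∈ Ioo 0 t ↔ τ ∈ Ioo 0 t := by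
      constructor <;> rintro ⟨h0, h1⟩ <;> constructor <;> linarith
    by_cases hτ : τ ∈ Ioo 0 t
    · rw [indicator_of_mem hτ, indicator_of_mem (hiff.2 hτ)]
    · rw [indicator_of_notMem hτ, indicator_of_notMem (mt hiff.1 hτ)]
  calc _ ≤ ∫⁻ τ in Ioo 0 t,
        (ENNReal.ofReal (D / Real.Gamma α * (1 + t) ^ (α - 1)) * ENNReal.ofReal ((1 + τ) ^ (-q)) +
        ENNReal.ofReal ((1 / 2) ^ (-q) / Real.Gamma α * (1 + t) ^ (-q)) *
          ENNReal.ofReal ((t - τ) ^ (α - 1))) := setLIntegral_mono' measurableSet_Ioo key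
    _ ≤ ENNReal.ofReal (D / Real.Gamma α * (1 + t) ^ (α - 1)) * ENNReal.ofReal A +
        ENNReal.ofReal ((1 / 2) ^ (-q) / Real.Gamma α * (1 + t) ^ (-q)) *
          ENNReal.ofReal (t ^ α / α) := by
        rw [lintegral_add_left (by fun_prop), lintegral_const_mul' _ _ ENNReal.ofReal_ne_top,
          lintegral_const_mul' _ _ ENNReal.ofReal_ne_top, hrefl, hA, ENNReal.ofReal_toReal hI.ne]
        gcongr
        exact Ioo_subset_Ioi_self
    _ ≤ _ := by
        rw [← ENNReal.ofReal_mul (by positivity), ← ENNReal.ofReal_mul (by positivity),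
          ← ENNReal.ofReal_add (by positivity) (by positivity)]
        apply ENNReal.ofReal_le_ofReal
        have e : (1 + t) ^ (-q) * t ^ α ≤ (1 + t) ^ (α - 1) := by
          calc (1 + t) ^ (-q) * t ^ α ≤ (1 + t) ^ (-q) * (1 + t) ^ α := by
                gcongr
                linarith
            _ = (1 + t) ^ (-q + α) := (Real.rpow_add ht1 _ _).symm
            _ ≤ _ := Real.rpow_le_rpow_of_exponent_le (by linarith) (by linarith)
        calc _ = D / Real.Gamma α * A * (1 + t) ^ (α - 1) +
              (1 / 2) ^ (-q) / Real.Gamma α / α * ((1 + t) ^ (-q) * t ^ α) := by ring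
          _ ≤ D / Real.Gamma α * A * (1 + t) ^ (α - 1) +
              (1 / 2) ^ (-q) / Real.Gamma α / α * (1 + t) ^ (α - 1) := by gcongr
          _ = _ := by ring

/-- A self-similarly spreading and decaying source, switched on at time `0`. -/
noncomputable def source (n : ℕ) (q ε : ℝ) (z : SpaceTime n) : ℝ :=
  if 0 < z.2 then ε * (1 + z.2) ^ (-q) * heat n z.1 (1 + z.2) else 0

lemma measurable_source (n : ℕ) (q ε : ℝ) : Measurable (source n q ε) := by
  refine Measurable.ite (measurableSet_lt measurable_const measurable_snd)
    (Measurable.mul (by fun_prop) ?_) measurable_const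
  exact (measurable_heat n).comp (g := fun p : SpaceTime n => heat n p.1 p.2)
    (f := fun z : SpaceTime n => (z.1, 1 + z.2)) (by fun_prop)

lemma source_pos {n : ℕ} {q ε : ℝ} (hε : 0 < ε) {z : SpaceTime n} (hz : 0 < z.2) :
    0 < source n q ε z := by
  rw [source, if_pos hz]
  have := heat_pos z.1 (by linarith : 0 < 1 + z.2)
  positivity

lemma source_of_nonpos {n : ℕ} {q ε : ℝ} {z : SpaceTime n} (hz : z.2 ≤ 0) :
    source n q ε z = 0 := by
  rw [source, if_neg hz.not_gt]

lemma source_nonneg {n : ℕ} {q ε : ℝ} (hε : 0 < ε) (z : SpaceTime n) : 0 ≤ source n q ε z := by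
  rcases lt_or_ge 0 z.2 with h | h
  · exact (source_pos hε h).le
  · exact (source_of_nonpos h).ge

lemma source_mem_X {n : ℕ} {q ε : ℝ} (hq : 0 ≤ q) (hε : 0 < ε) : source n q ε ∈ X n 1 := by
  intro T
  refine memLp_one_iff_integrable.2 ⟨(measurable_source n q ε).aestronglyMeasurable, ?_⟩
  rw [hasFiniteIntegral_iff_ofReal (.of_forall fun z => source_nonneg hε z)]
  have hm : Measurable fun z => ENNReal.ofReal (source n q ε z) :=
    (measurable_source n q ε).ennreal_ofReal
  rw [past, Measure.volume_eq_prod, ← Measure.prod_restrict, Measure.restrict_univ,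
    lintegral_prod_symm _ hm.aemeasurable]
  have key : ∀ t : ℝ, ∫⁻ x : EuclideanSpace ℝ (Fin n), ENNReal.ofReal (source n q ε (x, t)) ≤
      (Ioi 0).indicator (fun _ => ENNReal.ofReal ε) t := by
    intro t
    rcases lt_or_ge 0 t with ht | ht
    · rw [indicator_of_mem (mem_Ioi.2 ht)]
      calc _ ≤ ∫⁻ x : EuclideanSpace ℝ (Fin n),
            ENNReal.ofReal ε * ENNReal.ofReal (heat n x (1 + t)) := by
            refine lintegral_mono fun x => ?_
            have hh := heat_pos x (by linarith : 0 < 1 + t)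
            rw [← ENNReal.ofReal_mul hε.le, source, if_pos ht]
            apply ENNReal.ofReal_le_ofReal
            have : (1 + t) ^ (-q) ≤ 1 :=
              Real.rpow_le_one_of_one_le_of_nonpos (by linarith) (by linarith)
            calc _ ≤ ε * 1 * heat n x (1 + t) := by gcongr
              _ = _ := by ring
        _ = ENNReal.ofReal ε := by
            rw [lintegral_const_mul' _ _ ENNReal.ofReal_ne_top, lintegral_heat (by linarith),
              mul_one]
    · simp [source_of_nonpos (z := ((_, t) : SpaceTime n)) ht]
  calc _ ≤ ∫⁻ t in Iio T, (Ioi 0).indicator (fun _ => ENNReal.ofReal ε) t :=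
        lintegral_mono fun t => key t
    _ = ENNReal.ofReal ε * volume (Ioo 0 T) := by
        rw [lintegral_indicator_const measurableSet_Ioi,
          Measure.restrict_apply measurableSet_Ioi, Ioi_inter_Iio]
    _ < ⊤ := ENNReal.mul_lt_top ENNReal.ofReal_lt_top measure_Ioo_lt_top

/-- The source emitted at any time `τ` has heat profile `1 + τ`, which evolves to profile `1 + t` at
time `t`. Hence the space dependence factors out of the time integral. -/
lemma pot_source {n : ℕ} {α q ε : ℝ} (hα : 0 < α) (hε : 0 < ε) (z : SpaceTime n) :
    pot n α (fun w => ENNReal.ofReal (source n q ε w)) z =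
      ENNReal.ofReal (ε * heat n z.1 (1 + z.2)) *
        ∫⁻ τ in Ioo 0 z.2,
          ENNReal.ofReal ((z.2 - τ) ^ (α - 1) / Real.Gamma α * (1 + τ) ^ (-q)) := by
  have hΓ := Real.Gamma_pos_of_pos hα
  have hm : Measurable fun w : SpaceTime n =>
      ENNReal.ofReal (kernel n α (z.1 - w.1) (z.2 - w.2)) * ENNReal.ofReal (source n q ε w) :=
    ((measurable_ofReal_kernel_sub n α).comp (measurable_const.prodMk measurable_id)).mul
      (measurable_source n q ε).ennreal_ofReal
  rw [pot, Measure.volume_eq_prod, lintegral_prod_symm _ hm.aemeasurable,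
    ← lintegral_const_mul' _ _ ENNReal.ofReal_ne_top, ← lintegral_indicator measurableSet_Ioo]
  refine lintegral_congr fun τ => ?_
  by_cases hτ : τ ∈ Ioo 0 z.2
  · obtain ⟨h0, h1⟩ := id hτ
    have hs : 0 < z.2 - τ := by linarith
    have hh := heat_pos z.1 (by linarith : 0 < 1 + z.2)
    have e : ∀ x, ENNReal.ofReal (kernel n α (z.1 - x) (z.2 - τ)) *
        ENNReal.ofReal (source n q ε (x, τ)) =
        ENNReal.ofReal (ε * ((z.2 - τ) ^ (α - 1) / Real.Gamma α * (1 + τ) ^ (-q))) *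
          ENNReal.ofReal (heat n (z.1 - x) (z.2 - τ) * heat n x (1 + τ)) := by
      intro x
      rw [← ENNReal.ofReal_mul (kernel_nonneg hα _ _), ← ENNReal.ofReal_mul (by positivity),
        kernel_of_pos α _ hs, source, if_pos h0]
      congr 1
      ring
    simp_rw [e]
    rw [lintegral_const_mul' _ _ ENNReal.ofReal_ne_top,
      lintegral_heat_mul_heat _ hs (by linarith), indicator_of_mem hτ,
      ← ENNReal.ofReal_mul (by positivity), ← ENNReal.ofReal_mul (by positivity),
      show z.2 - τ + (1 + τ) = 1 + z.2 by ring]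
    congr 1
    ring
  · rw [indicator_of_notMem hτ]
    have e : ∀ x, ENNReal.ofReal (kernel n α (z.1 - x) (z.2 - τ)) *
        ENNReal.ofReal (source n q ε (x, τ)) = 0 := by
      intro x
      rcases le_or_gt τ 0 with h | h
      · rw [source_of_nonpos (z := ((x, τ) : SpaceTime n)) h, ENNReal.ofReal_zero, mul_zero]
      · rw [kernel_of_nonpos, ENNReal.ofReal_zero, zero_mul]
        by_contra h'
        exact hτ ⟨h, by linarith⟩
    simp [e]

lemma exists_source_superSolution {n : ℕ} {α lam : ℝ} (hα : 0 < α) (hlam : 1 < lam)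
    (hcrit : ((n : ℝ) + 2) / 2 < lam * (((n : ℝ) + 2) / 2 - α)) :
    ∃ u : SpaceTime n → ℝ, IsNonnegSuperSolution n 1 α lam u ∧ ¬ u =ᵐ[volume] 0 := by
  have hΓ := Real.Gamma_pos_of_pos hα
  -- The decay rate of `u^λ` once one factor `heat` is kept and the other `λ - 1` are bounded by
  -- `(1+t)^(-n/2)`.
  set q := lam * (((n : ℝ) + 2) / 2 - α) - n / 2 with hq
  have hq1 : 1 < q := by linarith
  obtain ⟨C, hC, hI⟩ := exists_lintegral_time_le hα hq1
  -- The solution of `(ε C)^λ = ε`.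
  set ε := C ^ (lam / (1 - lam)) with hε
  have hε0 : 0 < ε := by positivity
  have hεC : (ε * C) ^ lam = ε := by
    have h1 : 1 - lam ≠ 0 := by linarith
    nth_rw 1 [← Real.rpow_one C]
    rw [hε, ← Real.rpow_add hC, ← Real.rpow_mul hC.le]
    congr 1
    field_simp
    ring
  set f := source n q ε with hf
  have hfX : f ∈ X n 1 := source_mem_X (by linarith) hε0
  have hJ : ∀ z, J n α f z = (pot n α (fun w => ENNReal.ofReal (f w)) z).toReal :=
    J_eq_toReal_pot hα hfX (.of_forall fun z => source_nonneg hε0 z)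
  have hpot : ∀ z : SpaceTime n, 0 < z.2 → pot n α (fun w => ENNReal.ofReal (f w)) z ≤
      ENNReal.ofReal (ε * C * (1 + z.2) ^ (α - 1) * heat n z.1 (1 + z.2)) := by
    intro z hz
    have hh := heat_pos z.1 (by linarith : 0 < 1 + z.2)
    rw [hf, pot_source hα hε0]
    calc _ ≤ ENNReal.ofReal (ε * heat n z.1 (1 + z.2)) *
          ENNReal.ofReal (C * (1 + z.2) ^ (α - 1)) := by
          gcongr
          exact hI z.2 hz
      _ = _ := by
          rw [← ENNReal.ofReal_mul (by positivity)]
          congr 1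
          ring
  have hzero : ∀ z : SpaceTime n, z.2 ≤ 0 → J n α f z = 0 := by
    intro z hz
    rw [hJ, hf, pot_source hα hε0, Ioo_eq_empty hz.not_gt]
    simp
  refine ⟨J n α f, ⟨⟨f, hfX, .rfl⟩, .of_forall fun z => ?_, ⟨f, ⟨hfX, .rfl⟩, .of_forall fun z => ?_⟩,
    .of_forall fun z hz => hzero z ?_⟩, fun h => ?_⟩
  · rw [hJ]
    exact ENNReal.toReal_nonneg
  · rcases lt_or_ge 0 z.2 with hz | hz
    · have hz1 : 0 < 1 + z.2 := by linarith
      have hh := heat_pos z.1 hz1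
      have h1 : J n α f z ≤ ε * C * (1 + z.2) ^ (α - 1) * heat n z.1 (1 + z.2) := by
        rw [hJ]
        exact ENNReal.toReal_le_of_le_ofReal (by positivity) (hpot z hz)
      have h2 : heat n z.1 (1 + z.2) ^ (lam - 1) ≤ (1 + z.2) ^ (-((n : ℝ) / 2) * (lam - 1)) := by
        rw [Real.rpow_mul hz1.le]
        exact Real.rpow_le_rpow hh.le (heat_le _ hz1) (by linarith)
      have h0 : 0 ≤ J n α f z := by
        rw [hJ]
        exact ENNReal.toReal_nonneg
      calc J n α f z ^ lam ≤ (ε * C * (1 + z.2) ^ (α - 1) * heat n z.1 (1 + z.2)) ^ lam :=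
            Real.rpow_le_rpow h0 h1 (by linarith)
        _ = ε * (1 + z.2) ^ ((α - 1) * lam) *
            (heat n z.1 (1 + z.2) ^ (lam - 1) * heat n z.1 (1 + z.2)) := by
            rw [Real.mul_rpow (by positivity) hh.le, Real.mul_rpow (by positivity) (by positivity),
              hεC, ← Real.rpow_mul hz1.le, ← Real.rpow_add_one hh.ne', sub_add_cancel]
        _ ≤ ε * (1 + z.2) ^ ((α - 1) * lam) *
            ((1 + z.2) ^ (-((n : ℝ) / 2) * (lam - 1)) * heat n z.1 (1 + z.2)) := by gcongr
        _ = ε * (1 + z.2) ^ (-q) * heat n z.1 (1 + z.2) := by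
            rw [show -q = (α - 1) * lam + -((n : ℝ) / 2) * (lam - 1) by rw [hq]; ring,
              Real.rpow_add hz1]
            ring
        _ = f z := by rw [hf, source, if_pos hz]
    · rw [hzero z hz, Real.zero_rpow (by linarith)]
      exact source_nonneg hε0 z
  · exact (show z.2 < 0 from hz.2).le
  -- `toReal` vanishes at `0` and at `⊤`; positivity of the integrand excludes the first, `hpot` the
  -- second.
  · have hne : ∀ z : SpaceTime n, 0 < z.2 → J n α f z ≠ 0 := by
      intro z hz h0
      rw [hJ, ENNReal.toReal_eq_zero_iff] at h0
      have hh := heat_pos z.1 (by linarith : 0 < 1 + z.2)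
      rcases h0 with h0 | h0
      · rw [hf, pot_source hα hε0, mul_eq_zero] at h0
        rcases h0 with h0 | h0
        · rw [ENNReal.ofReal_eq_zero] at h0
          have : 0 < ε * heat n z.1 (1 + z.2) := by positivity
          linarith
        · rw [setLIntegral_eq_zero_iff measurableSet_Ioo (by fun_prop)] at h0
          have h3 : ∀ᵐ τ : ℝ, τ ∉ Ioo 0 z.2 := by
            filter_upwards [h0] with τ hτ hmem
            have h4 := hτ hmem
            rw [ENNReal.ofReal_eq_zero] at h4
            have hs : 0 < z.2 - τ := by linarith [hmem.2]
            have hs' : 0 < 1 + τ := by linarith [hmem.1]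
            have : 0 < (z.2 - τ) ^ (α - 1) / Real.Gamma α * (1 + τ) ^ (-q) := by positivity
            linarith
          rw [ae_iff] at h3
          simp only [not_not, ofPred_mem_eq, Real.volume_Ioo, sub_zero,
            ENNReal.ofReal_eq_zero] at h3
          linarith
      · exact ((hpot z hz).trans_lt ENNReal.ofReal_lt_top).ne h0
    have h5 : volume (univ ×ˢ Ioi 0 : Set (SpaceTime n)) = 0 :=
      measure_mono_null (fun z hz => hne z hz.2) (ae_iff.1 h)
    rw [Measure.volume_eq_prod, Measure.prod_prod] at h5
    rcases mul_eq_zero.1 h5 with h6 | h6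
    · exact (isOpen_univ.measure_pos volume univ_nonempty).ne' h6
    · simp at h6

end FracHeat

/-! ### The dichotomy at the critical exponent -/

theorem corollary1p2 (n : ℕ) (hn : 1 ≤ n) :
    (∀ α lam : ℝ, 0 < α → α ≤ ((n : ℝ) + 2) / 2 → 1 < lam →
      ((∃ u : FracHeat.SpaceTime n → ℝ,
          FracHeat.IsNonnegSuperSolution n 1 α lam u ∧ ¬ u =ᵐ[volume] 0) ↔
        α ≠ ((n : ℝ) + 2) / 2 ∧ FracHeat.criticalExponent n α < lam)) ∧
    FracHeat.criticalExponent n 1 = 1 + 2 / (n : ℝ) := by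
  refine ⟨fun α lam hα hαn hlam => ?_, by simp [FracHeat.criticalExponent]⟩
  have hn0 : (0 : ℝ) ≤ n := n.cast_nonneg
  have hiff : (α ≠ ((n : ℝ) + 2) / 2 ∧ FracHeat.criticalExponent n α < lam) ↔
      ((n : ℝ) + 2) / 2 < lam * (((n : ℝ) + 2) / 2 - α) := by
    rcases hαn.eq_or_lt with h | h
    · simp only [h, ne_eq, not_true_eq_false, false_and, sub_self, mul_zero, false_iff, not_lt]
      linarith
    · have hpos : 0 < (n : ℝ) + 2 - 2 * α := by linarith
      rw [FracHeat.criticalExponent, ← lt_sub_iff_add_lt', div_lt_iff₀ hpos]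
      constructor
      · rintro ⟨-, h1⟩
        linarith
      · exact fun h1 => ⟨h.ne, by linarith⟩
  rw [hiff]
  refine ⟨fun ⟨u, hu, hu0⟩ => ?_, FracHeat.exists_source_superSolution hα hlam⟩
  by_contra hcrit
  apply hu0
  obtain ⟨f, ⟨hfX, huf⟩, hsup⟩ := hu.super
  have hf0 : ∀ᵐ z, 0 ≤ f z := by
    filter_upwards [hu.nonneg, hsup] with z h1 h2
    exact (Real.rpow_nonneg h1 lam).trans h2
  obtain ⟨g, hg, hfg, hfin, hpot, hJ⟩ := FracHeat.exists_measurable_rep hα hαn hfX hf0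
  have hg0 : g =ᵐ[volume] 0 := by
    refine FracHeat.ae_eq_zero_of_pot_rpow_le hα hαn hlam (not_lt.1 hcrit) hg hfin ?_
    filter_upwards [hpot, huf, hfg, hsup, hu.nonneg] with z h1 h2 h3 h4 h5
    rw [hJ] at h2
    rw [← ENNReal.ofReal_toReal h1.ne, ← h2, ← h3, ENNReal.ofReal_rpow_of_nonneg h5 (by linarith)]
    exact ENNReal.ofReal_le_ofReal h4
  filter_upwards [huf] with z hz
  rw [hz, hJ, FracHeat.pot_congr hg0]
  simp [FracHeat.pot]
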